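/- Let $d \ge 0$ and $N \ge 1$, and let $f_1,\dots,f_N : \mathbb R^d \to \mathbb R^d$ be a self-affine system, i.e. each $f_j$ is an affine map that is a contraction for the Euclidean norm (Lipschitz with some constant less than $1$) and all complex eigenvalues $\lambda$ of its linear part satisfy $0 < |\lambda| < 1$. For $A \subseteq \mathbb R^d$ put $\Phi(A) = \bigcup_{j=1}^N f_j(A)$, and let $F$ be the self-affine set generated by the system, i.e. the unique nonempty compact set with $\Phi(F) = F$. A feasible open set is a nonempty open set $O \subseteq \mathbb R^d$ with $f_j(O) \subseteq O$ for all $j$ and $f_j(O) \cap f_k(O) = \emptyset$ for $j \neq k$. Suppose that the system satisfies the open set condition (OSC), i.e. that a feasible open set exists. Call $F$ non-trivial if there is a feasible open set $O$ with $O \not\subseteq \Phi(\overline{O})$. If the Hausdorff dimension of $F$ is strictly less than $d$, then $F$ is non-trivial. Moreover, if the system is self-similar, i.e. every $f_j$ has the form $f_j(x) = r_j A_j x + a_j$ with $0 < r_j < 1$, $A_j \in O(d)$ and $a_j \in \mathbb R^d$, then the converse also holds: if $F$ is non-trivial, then its Hausdorff dimension is strictly less than $d$. -/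

import Mathlib

open scoped NNReal ENNReal

/-- An affine contraction of Euclidean space `ℝ^d` (for the Euclidean norm), all of whose
eigenvalues `z` satisfy `0 < |z| < 1`. The eigenvalues are those of the linear part, i.e. the
complex roots of its characteristic polynomial. -/
def IsAffineContraction {d : ℕ}
    (f : EuclideanSpace ℝ (Fin d) →ᵃ[ℝ] EuclideanSpace ℝ (Fin d)) : Prop :=
  (∃ K : ℝ≥0, ContractingWith K (f : EuclideanSpace ℝ (Fin d) → EuclideanSpace ℝ (Fin d))) ∧
    ∀ z : ℂ, (f.linear.charpoly.map (algebraMap ℝ ℂ)).IsRoot z → 0 < ‖z‖ ∧ ‖z‖ < 1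

/-- A contracting similitude `x ↦ r A x + a` with `0 < r < 1`, `A ∈ O(d)`, `a ∈ ℝ^d`. -/
def IsSimilitude {d : ℕ}
    (f : EuclideanSpace ℝ (Fin d) →ᵃ[ℝ] EuclideanSpace ℝ (Fin d)) : Prop :=
  ∃ (r : ℝ) (A : EuclideanSpace ℝ (Fin d) ≃ₗᵢ[ℝ] EuclideanSpace ℝ (Fin d))
    (a : EuclideanSpace ℝ (Fin d)), 0 < r ∧ r < 1 ∧ ∀ x, f x = r • A x + a

/-- A self-affine iterated function system. -/
def IsSelfAffineSystem {d N : ℕ}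
    (f : Fin N → EuclideanSpace ℝ (Fin d) →ᵃ[ℝ] EuclideanSpace ℝ (Fin d)) : Prop :=
  ∀ j, IsAffineContraction (f j)

/-- A self-similar system: a self-affine system consisting of similitudes. -/
def IsSelfSimilarSystem {d N : ℕ}
    (f : Fin N → EuclideanSpace ℝ (Fin d) →ᵃ[ℝ] EuclideanSpace ℝ (Fin d)) : Prop :=
  IsSelfAffineSystem f ∧ ∀ j, IsSimilitude (f j)

/-- The set mapping `A ↦ f_1(A) ∪ ⋯ ∪ f_N(A)` of a system. -/
def systemImage {d N : ℕ}
    (f : Fin N → EuclideanSpace ℝ (Fin d) →ᵃ[ℝ] EuclideanSpace ℝ (Fin d))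
    (A : Set (EuclideanSpace ℝ (Fin d))) : Set (EuclideanSpace ℝ (Fin d)) :=
  ⋃ j, f j '' A

/-- `F` is the attractor of the system: the nonempty compact invariant set. -/
def IsAttractor {d N : ℕ}
    (f : Fin N → EuclideanSpace ℝ (Fin d) →ᵃ[ℝ] EuclideanSpace ℝ (Fin d))
    (F : Set (EuclideanSpace ℝ (Fin d))) : Prop :=
  F.Nonempty ∧ IsCompact F ∧ systemImage f F = F

/-- `O` is a feasible open set of the system. -/
def IsFeasible {d N : ℕ}
    (f : Fin N → EuclideanSpace ℝ (Fin d) →ᵃ[ℝ] EuclideanSpace ℝ (Fin d))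
    (O : Set (EuclideanSpace ℝ (Fin d))) : Prop :=
  O.Nonempty ∧ IsOpen O ∧ (∀ j, f j '' O ⊆ O) ∧ ∀ j k, j ≠ k → f j '' O ∩ f k '' O = ∅

/-- The open set condition. -/
def SatisfiesOSC {d N : ℕ}
    (f : Fin N → EuclideanSpace ℝ (Fin d) →ᵃ[ℝ] EuclideanSpace ℝ (Fin d)) : Prop :=
  ∃ O, IsFeasible f O

/-- Non-triviality (of the attractor of a system with the open set condition): some feasible
open set is not covered by the images of its closure. -/
def IsNontrivial {d N : ℕ}
    (f : Fin N → EuclideanSpace ℝ (Fin d) →ᵃ[ℝ] EuclideanSpace ℝ (Fin d)) : Prop :=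
  ∃ O, IsFeasible f O ∧ ¬ O ⊆ systemImage f (closure O)

open MeasureTheory Metric Set Filter Topology
open scoped Pointwise

/-! Intersecting with a large ball makes a feasible set bounded (`IsFeasible.exists_bounded`). If a
bounded feasible `O` lies in `Φ(closure O)`, so does `closure O`, whence `closure O ⊆ F` by
`subset_attractor`; then `F` has interior and dimension `d`. For similitudes, non-triviality leaves
an open gap of positive volume in `O` beside the disjoint `f j '' O`, so `∑ r_j ^ d < 1`. By
continuity `∑ r_j ^ s < 1` for some `s < d`, and iterated covers give `dimH F ≤ s`. -/

/-- An affine contraction maps every sufficiently large ball about the origin into itself. -/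
theorem exists_image_ball_subset {d : ℕ}
    {f : EuclideanSpace ℝ (Fin d) →ᵃ[ℝ] EuclideanSpace ℝ (Fin d)} (hf : IsAffineContraction f) :
    ∃ R₀ : ℝ, ∀ R > R₀, f '' ball 0 R ⊆ ball 0 R := by
  obtain ⟨⟨K, hK1, hK⟩, -⟩ := hf
  have hK1' : (K : ℝ) < 1 := by exact_mod_cast hK1
  -- Beyond this threshold `K * R + ‖f 0‖ < R`.
  refine ⟨‖f 0‖ / (1 - K), fun R hR => ?_⟩
  rintro _ ⟨x, hx, rfl⟩
  rw [mem_ball_zero_iff] at hx ⊢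
  have h1 : ‖f x - f 0‖ ≤ K * ‖x‖ := by
    simpa [dist_eq_norm] using hK.dist_le_mul x 0
  have h2 : ‖f x‖ ≤ ‖f x - f 0‖ + ‖f 0‖ := by
    simpa using norm_add_le (f x - f 0) (f 0)
  have h3 : ‖f 0‖ < R * (1 - K) := (div_lt_iff₀ (by linarith)).1 hR
  have h4 : (K : ℝ) * ‖x‖ ≤ K * R := mul_le_mul_of_nonneg_left hx.le K.2
  linarith

/-- A common threshold for all the maps of a self-affine system. -/
theorem IsSelfAffineSystem.exists_image_ball_subset {d N : ℕ}
    {f : Fin N → EuclideanSpace ℝ (Fin d) →ᵃ[ℝ] EuclideanSpace ℝ (Fin d)}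
    (hf : IsSelfAffineSystem f) :
    ∃ R₀ : ℝ, ∀ R > R₀, ∀ j, f j '' ball 0 R ⊆ ball 0 R := by
  choose R₀ hR₀ using fun j => _root_.exists_image_ball_subset (hf j)
  obtain ⟨M, hM⟩ := (finite_range R₀).bddAbove
  exact ⟨M, fun R hR j => hR₀ j R ((hM (mem_range_self j)).trans_lt hR)⟩

theorem systemImage_mono {d N : ℕ}
    (f : Fin N → EuclideanSpace ℝ (Fin d) →ᵃ[ℝ] EuclideanSpace ℝ (Fin d))
    {A B : Set (EuclideanSpace ℝ (Fin d))} (h : A ⊆ B) : systemImage f A ⊆ systemImage f B :=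
  iUnion_mono fun _ => image_mono h

theorem isCompact_systemImage {d N : ℕ}
    (f : Fin N → EuclideanSpace ℝ (Fin d) →ᵃ[ℝ] EuclideanSpace ℝ (Fin d))
    {A : Set (EuclideanSpace ℝ (Fin d))} (h : IsCompact A) : IsCompact (systemImage f A) :=
  isCompact_iUnion fun j => h.image (f j).continuous_of_finiteDimensional

/-- Every point of a feasible open set lies in a bounded feasible open subset. -/
theorem IsFeasible.exists_bounded {d N : ℕ}
    {f : Fin N → EuclideanSpace ℝ (Fin d) →ᵃ[ℝ] EuclideanSpace ℝ (Fin d)}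
    (hf : IsSelfAffineSystem f) {O : Set (EuclideanSpace ℝ (Fin d))} (hO : IsFeasible f O)
    {x : EuclideanSpace ℝ (Fin d)} (hx : x ∈ O) :
    ∃ U, IsFeasible f U ∧ Bornology.IsBounded U ∧ U ⊆ O ∧ x ∈ U := by
  obtain ⟨R₀, hR₀⟩ := hf.exists_image_ball_subset
  set R := max R₀ ‖x‖ + 1
  have hR : R > R₀ := (le_max_left _ _).trans_lt (lt_add_one _)
  have hxR : x ∈ ball (0 : EuclideanSpace ℝ (Fin d)) R :=
    mem_ball_zero_iff.2 ((le_max_right _ _).trans_lt (lt_add_one _))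
  refine ⟨O ∩ ball 0 R, ⟨⟨x, hx, hxR⟩, hO.2.1.inter isOpen_ball, fun j => ?_, fun j k hjk => ?_⟩,
    isBounded_ball.subset inter_subset_right, inter_subset_left, hx, hxR⟩
  · exact (image_inter_subset _ _ _).trans (inter_subset_inter (hO.2.2.1 j) (hR₀ R hR j))
  · exact subset_eq_empty (inter_subset_inter (image_mono inter_subset_left)
      (image_mono inter_subset_left)) (hO.2.2.2 j k hjk)

/-- Finite covers of a set `F` with `F ⊆ ⋃ j, g j '' F`, obtained by iterating the system. -/
theorem exists_cover_of_subset_iUnion_image {X : Type*} [PseudoEMetricSpace X] {N : ℕ}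
    {g : Fin N → X → X} {r : Fin N → ℝ≥0} (hg : ∀ j, LipschitzWith (r j) (g j)) {ρ : ℝ≥0}
    (hρ : ∀ j, r j ≤ ρ) {F : Set X} (hF : F ⊆ ⋃ j, g j '' F) {s : ℝ} (hs : 0 ≤ s) (n : ℕ) :
    ∃ (ι : Type) (_ : Fintype ι) (t : ι → Set X), F ⊆ ⋃ i, t i ∧
      (∀ i, ediam (t i) ≤ ρ ^ n * ediam F) ∧
      ∑ i, ediam (t i) ^ s ≤ (∑ j, (r j : ℝ≥0∞) ^ s) ^ n * ediam F ^ s := by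
  induction n with
  | zero =>
    refine ⟨Unit, inferInstance, fun _ => F, ?_, ?_, ?_⟩
    · exact fun x hx => mem_iUnion.2 ⟨(), hx⟩
    · simp
    · simp
  | succ n ih =>
    obtain ⟨ι, _, t, hcov, hdiam, hsum⟩ := ih
    have hle : ∀ j i, ediam (g j '' t i) ≤ r j * ediam (t i) := fun j i =>
      (hg j).ediam_image_le (t i)
    -- The new map is applied outermost, so the cover of `F` is simply pushed through `hF`.
    refine ⟨Fin N × ι, inferInstance, fun p => g p.1 '' t p.2, ?_, ?_, ?_⟩
    · intro x hx
      obtain ⟨j, y, hy, rfl⟩ := mem_iUnion.1 (hF hx)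
      obtain ⟨i, hi⟩ := mem_iUnion.1 (hcov hy)
      exact mem_iUnion.2 ⟨(j, i), y, hi, rfl⟩
    · rintro ⟨j, i⟩
      calc ediam (g j '' t i) ≤ r j * ediam (t i) := hle j i
        _ ≤ ρ * (ρ ^ n * ediam F) := by
          gcongr
          · exact hρ j
          · exact hdiam i
        _ = ρ ^ (n + 1) * ediam F := by ring
    · rw [Fintype.sum_prod_type]
      calc ∑ j, ∑ i, ediam (g j '' t i) ^ s
          ≤ ∑ j, ∑ i, (r j : ℝ≥0∞) ^ s * ediam (t i) ^ s := by
            gcongr with j _ i _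
            rw [← ENNReal.mul_rpow_of_nonneg _ _ hs]
            exact ENNReal.rpow_le_rpow (hle j i) hs
        _ = (∑ j, (r j : ℝ≥0∞) ^ s) * ∑ i, ediam (t i) ^ s := by
            rw [Finset.sum_mul_sum]
        _ ≤ (∑ j, (r j : ℝ≥0∞) ^ s) * ((∑ j, (r j : ℝ≥0∞) ^ s) ^ n * ediam F ^ s) := by
            gcongr
        _ = (∑ j, (r j : ℝ≥0∞) ^ s) ^ (n + 1) * ediam F ^ s := by ring

/-- The upper bound for the Hausdorff dimension of a self-similar set. -/
theorem dimH_le_of_sum_rpow_lt_one {X : Type*} [EMetricSpace X] {N : ℕ} {g : Fin N → X → X}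
    {r : Fin N → ℝ≥0} (hg : ∀ j, LipschitzWith (r j) (g j)) (hr : ∀ j, r j < 1) {F : Set X}
    (hF : F ⊆ ⋃ j, g j '' F) (hbdd : ediam F ≠ ∞) {s : ℝ≥0}
    (hs : ∑ j, (r j : ℝ≥0∞) ^ (s : ℝ) < 1) : dimH F ≤ s := by
  borelize X
  obtain ⟨ρ, hρ1, hρ⟩ : ∃ ρ : ℝ≥0, ρ < 1 ∧ ∀ j, r j ≤ ρ :=
    ⟨Finset.univ.sup r, (Finset.sup_lt_iff one_pos).2 fun j _ => hr j,
      fun j => Finset.le_sup (Finset.mem_univ j)⟩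
  choose ι hι t hcov hdiam hsum using
    exists_cover_of_subset_iUnion_image hg hρ hF (s := s) s.2
  have htend : ∀ {c b : ℝ≥0∞}, c < 1 → b ≠ ∞ →
      Tendsto (fun n : ℕ => c ^ n * b) atTop (𝓝 0) := fun hc hb => by
    simpa using ENNReal.Tendsto.mul_const (ENNReal.tendsto_pow_atTop_nhds_zero_of_lt_one hc)
      (Or.inr hb)
  have hzero : μH[(s : ℝ)] F = 0 := by
    refine le_antisymm ?_ zero_le
    refine (Measure.hausdorffMeasure_le_liminf_sum (s : ℝ) F
      (fun n : ℕ => (ρ : ℝ≥0∞) ^ n * ediam F)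
      (htend (by exact_mod_cast hρ1) hbdd) t (Eventually.of_forall hdiam)
      (Eventually.of_forall hcov)).trans ?_
    have h0 := htend hs (ENNReal.rpow_ne_top_of_nonneg s.2 hbdd)
    rw [← h0.liminf_eq]
    exact liminf_le_liminf (Eventually.of_forall hsum)
  exact dimH_le_of_hausdorffMeasure_ne_top (by simp [hzero])

/-- A strict inequality `∑ r_j ^ d < 1` persists for some exponent smaller than `d`. -/
theorem exists_lt_sum_rpow_lt_one {N d : ℕ} (hN : 0 < N) {r : Fin N → ℝ≥0} (hr : ∀ j, 0 < r j)
    (h : ∑ j, r j ^ d < 1) :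
    ∃ s : ℝ≥0, s < d ∧ ∑ j, (r j : ℝ≥0∞) ^ (s : ℝ) < 1 := by
  -- For `d = 0` the sum would be `N ≥ 1`; positivity leaves room for an exponent below `d`.
  have hd : (0 : ℝ≥0) < d := by
    rcases Nat.eq_zero_or_pos d with rfl | hd
    · simp only [pow_zero, Finset.sum_const, Finset.card_univ, Fintype.card_fin, nsmul_eq_mul,
        mul_one] at h
      have : N < 1 := by exact_mod_cast h
      omega
    · exact_mod_cast hd
  have hcont : Continuous fun s : ℝ≥0 => ∑ j, r j ^ (s : ℝ) := by
    refine continuous_finsetSum _ fun j _ => ?_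
    rw [continuous_iff_continuousAt]
    exact fun s => (NNReal.continuousAt_rpow (Or.inl (hr j).ne')).comp
      (f := fun s : ℝ≥0 => (r j, (s : ℝ))) (by fun_prop)
  have hev : ∀ᶠ s : ℝ≥0 in 𝓝 (d : ℝ≥0), ∑ j, r j ^ (s : ℝ) < 1 :=
    hcont.continuousAt.eventually_lt continuousAt_const (by simpa using h)
  obtain ⟨l, hl, hlt⟩ := exists_Ioc_subset_of_mem_nhds hev ⟨0, hd⟩
  obtain ⟨s, hls, hsd⟩ := exists_between hl
  refine ⟨s, hsd, ?_⟩
  have : ∑ j, r j ^ (s : ℝ) < 1 := hlt ⟨hls, hsd.le⟩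
  rw [← ENNReal.coe_lt_coe] at this
  push_cast at this
  convert this using 2 with j
  exact (ENNReal.coe_rpow_of_nonneg _ s.2).symm

theorem IsSimilitude.exists_ratio {d : ℕ}
    {f : EuclideanSpace ℝ (Fin d) →ᵃ[ℝ] EuclideanSpace ℝ (Fin d)} (hf : IsSimilitude f) :
    ∃ r : ℝ≥0, 0 < r ∧ r < 1 ∧ LipschitzWith r f ∧ IsOpenMap f ∧
      ∀ s, volume (f '' s) = (r : ℝ≥0∞) ^ d * volume s := by
  obtain ⟨r, A, a, h0, h1, hfx⟩ := hf
  lift r to ℝ≥0 using h0.le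
  have himage : ∀ s : Set (EuclideanSpace ℝ (Fin d)),
      f '' s = (fun x => x + a) '' ((r : ℝ) • (A '' s)) := fun s => by
    ext y
    simp only [mem_image, mem_smul_set, exists_exists_and_eq_and, hfx]
  refine ⟨r, by exact_mod_cast h0, by exact_mod_cast h1, ?_, ?_, fun s => ?_⟩
  · refine LipschitzWith.of_dist_le_mul fun x y => ?_
    rw [hfx, hfx, dist_add_right, dist_smul₀, A.dist_map]
    simp
  · intro U hU
    rw [himage]
    exact isOpenMap_add_right a _ ((A.toHomeomorph.isOpenMap U hU).smul₀ h0.ne')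
  · rw [himage, image_add_right, measure_preimage_add_right, Measure.addHaar_smul_of_nonneg _ h0.le,
      finrank_euclideanSpace_fin,
      ← A.measurePreserving.measure_preimage_emb A.toHomeomorph.measurableEmbedding,
      A.injective.preimage_image, ENNReal.ofReal_pow h0.le, ENNReal.ofReal_coe_nnreal]

theorem dimH_lt_of_isNontrivial {d N : ℕ}
    {f : Fin N → EuclideanSpace ℝ (Fin d) →ᵃ[ℝ] EuclideanSpace ℝ (Fin d)}
    {F : Set (EuclideanSpace ℝ (Fin d))} (hF : IsAttractor f F) (hf : IsSelfSimilarSystem f)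
    (hnt : IsNontrivial f) : dimH F < (d : ℝ≥0∞) := by
  obtain ⟨O', hO', hnot⟩ := hnt
  obtain ⟨x, hxO', hx⟩ := not_subset.1 hnot
  obtain ⟨O, hO, hbdd, hsub, hxO⟩ := hO'.exists_bounded hf.1 hxO'
  -- Shrinking the feasible set also shrinks the image of its closure, so the witness `x` survives.
  have hxO2 : x ∉ systemImage f (closure O) := fun h =>
    hx (systemImage_mono f (closure_mono hsub) h)
  choose r hr0 hr1 hlip hopen hvol using fun j => (hf.2 j).exists_ratio
  have hUopen : IsOpen (O \ systemImage f (closure O)) :=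
    hO.2.1.sdiff (isCompact_systemImage f hbdd.isCompact_closure).isClosed
  have hUpos : 0 < volume (O \ systemImage f (closure O)) :=
    hUopen.measure_pos volume ⟨x, hxO, hxO2⟩
  have hOfin : volume O ≠ ∞ := hbdd.measure_lt_top.ne
  have hOpos : volume O ≠ 0 := (hO.2.1.measure_pos volume hO.1).ne'
  have hlt : (∑ j, (r j : ℝ≥0∞) ^ d) * volume O < 1 * volume O := by
    have hmeas : volume (⋃ j, f j '' O) = ∑ j, (r j : ℝ≥0∞) ^ d * volume O := by
      rw [measure_iUnion (fun j k hjk => disjoint_iff_inter_eq_empty.2 (hO.2.2.2 j k hjk))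
        fun j => (hopen j O hO.2.1).measurableSet, tsum_fintype]
      exact Finset.sum_congr rfl fun j _ => hvol j O
    rw [Finset.sum_mul, ← hmeas, one_mul]
    have hdisj : Disjoint (⋃ j, f j '' O) (O \ systemImage f (closure O)) :=
      disjoint_sdiff_right.mono_left (systemImage_mono f subset_closure)
    have hunion : (⋃ j, f j '' O) ∪ (O \ systemImage f (closure O)) ⊆ O :=
      union_subset (iUnion_subset hO.2.2.1) sdiff_subset
    have hle := measure_mono (μ := volume) hunion
    rw [measure_union hdisj hUopen.measurableSet] at hle
    -- Adding the gap is a strict increase only because the volume of the images is finite.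
    refine lt_of_lt_of_le (ENNReal.lt_add_right ?_ hUpos.ne') hle
    exact ne_top_of_le_ne_top hOfin (measure_mono (iUnion_subset hO.2.2.1))
  have hsum : ∑ j, r j ^ d < 1 := by
    have := lt_of_mul_lt_mul_right' hlt
    exact_mod_cast this
  have hN : 0 < N := by
    rcases Nat.eq_zero_or_pos N with rfl | hN
    · obtain ⟨y, hy⟩ := hF.1
      rw [← hF.2.2] at hy
      obtain ⟨j, -⟩ := mem_iUnion.1 hy
      exact j.elim0
    · exact hN
  obtain ⟨s, hsd, hs⟩ := exists_lt_sum_rpow_lt_one hN hr0 hsum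
  exact (dimH_le_of_sum_rpow_lt_one hlip hr1 hF.2.2.ge hF.2.1.isBounded.ediam_ne_top hs).trans_lt
    (by exact_mod_cast hsd)

/-- A nonempty compact set contained in its own image is contained in the attractor. -/
theorem subset_attractor {d N : ℕ}
    {f : Fin N → EuclideanSpace ℝ (Fin d) →ᵃ[ℝ] EuclideanSpace ℝ (Fin d)}
    (hf : IsSelfAffineSystem f) {F : Set (EuclideanSpace ℝ (Fin d))} (hF : IsAttractor f F)
    {C : Set (EuclideanSpace ℝ (Fin d))} (hC : IsCompact C) (hsub : C ⊆ systemImage f C) :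
    C ⊆ F := by
  choose K hK using fun j => (hf j).1
  have hcont : Continuous fun x => infDist x F := continuous_infDist_pt F
  rcases C.eq_empty_or_nonempty with rfl | hne
  · exact empty_subset F
  -- The largest distance `m` from a point of `C` to `F` satisfies `m ≤ K j * m` with `K j < 1`, so
  -- `m = 0`.
  obtain ⟨x, hxC, hmax⟩ := hC.exists_isMaxOn hne hcont.continuousOn
  obtain ⟨j, y, hyC, rfl⟩ := mem_iUnion.1 (hsub hxC)
  obtain ⟨z, hzF, hz⟩ := hF.2.1.exists_infDist_eq_dist hF.1 y
  have hfz : f j z ∈ F := hF.2.2 ▸ mem_iUnion.2 ⟨j, z, hzF, rfl⟩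
  have h1 : infDist (f j y) F ≤ K j * infDist y F := by
    rw [hz]
    exact (infDist_le_dist_of_mem hfz).trans ((hK j).2.dist_le_mul y z)
  have h2 : infDist y F ≤ infDist (f j y) F := hmax hyC
  have hK1 : (K j : ℝ) < 1 := by exact_mod_cast (hK j).1
  have h3 : infDist (f j y) F ≤ 0 := by
    nlinarith [infDist_nonneg (x := y) (s := F), (K j).2]
  intro w hw
  have h4 : infDist w F ≤ infDist (f j y) F := hmax hw
  exact (hF.2.1.isClosed.mem_iff_infDist_zero hF.1).2 (le_antisymm (h4.trans h3) infDist_nonneg)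

theorem isNontrivial_of_dimH_lt {d N : ℕ}
    {f : Fin N → EuclideanSpace ℝ (Fin d) →ᵃ[ℝ] EuclideanSpace ℝ (Fin d)}
    (hf : IsSelfAffineSystem f) {F : Set (EuclideanSpace ℝ (Fin d))} (hF : IsAttractor f F)
    (hOSC : SatisfiesOSC f) (hdim : dimH F < (d : ℝ≥0∞)) : IsNontrivial f := by
  obtain ⟨O', hO'⟩ := hOSC
  obtain ⟨x, hx⟩ := hO'.1
  obtain ⟨O, hO, hbdd, -, hxO⟩ := hO'.exists_bounded hf hx
  refine ⟨O, hO, fun hcov => hdim.ne ?_⟩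
  have hC : IsCompact (closure O) := hbdd.isCompact_closure
  have hCF : closure O ⊆ F := subset_attractor hf hF hC
    (closure_minimal hcov (isCompact_systemImage f hC).isClosed)
  have hint : (interior F).Nonempty :=
    ⟨x, interior_mono (subset_closure.trans hCF) (hO.2.1.interior_eq.symm ▸ hxO)⟩
  rw [Real.dimH_of_nonempty_interior hint, finrank_euclideanSpace_fin]

theorem mainTheorem8 {d N : ℕ}
    (f : Fin N → EuclideanSpace ℝ (Fin d) →ᵃ[ℝ] EuclideanSpace ℝ (Fin d))
    (hf : IsSelfAffineSystem f)
    (F : Set (EuclideanSpace ℝ (Fin d))) (hF : IsAttractor f F) (hOSC : SatisfiesOSC f) :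
    (dimH F < (d : ℝ≥0∞) → IsNontrivial f) ∧
      (IsSelfSimilarSystem f → IsNontrivial f → dimH F < (d : ℝ≥0∞)) :=
  ⟨isNontrivial_of_dimH_lt hf hF hOSC, dimH_lt_of_isNontrivial hF⟩
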